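/- Let $E=(E^0,E^1,r,s)$ be a directed graph with at least one edge, let $K$ be a field, and let $\mathbb F$ be the free group on $E^1$. Let $L_K(E)$ be the Leavitt path algebra: the associative (not necessarily unital) $K$-algebra generated by pairwise orthogonal idempotents $v$ ($v\in E^0$) and elements $f,f^*$ ($f\in E^1$) subject to $s(f)f=fr(f)=f$ and $r(f)f^*=f^*s(f)=f^*$ for $f \in E^1$, $f^*f'=\delta_{f,f'}r(f)$ for $f,f'\in E^1$, and $v=\sum_{s(f)=v}ff^*$ for every $v\in E^0$ such that $s^{-1}(v)$ is finite and non-empty. Equip $L_K(E)=\bigoplus_{g\in\mathbb F}L_K(E)_g$ with the $\mathbb F$-grading in which $v$ has degree $1$, $f$ has degree $f$ and $f^*$ has degree $f^{-1}$; that is, $L_K(E)_g$ is the $K$-linear span of the words in the generators whose degree in $\mathbb F$ is $g$. Say that a graded ring $R$ is graded unit-regular if it has an identity and every homogeneous $x\in R$ (that is, every nonzero element of some component) can be written as $x=xux$ with $u\in R$ homogeneous and invertible. Then $L_K(E)$ is graded unit-regular if and only if $E$ is a loop, i.e. $E$ consists of exactly one vertex and exactly one edge, which starts and ends at that vertex.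 -/

import Mathlib

universe u v w

/-! ### Graded rings and graded unit-regularity -/

/-- A grading of a (not necessarily unital) associative ring `R` by a group `G`: additive subgroups
`R_g` (`g ∈ G`) such that `R = ⨁ R_g` (internal direct sum) and `R_g R_h ⊆ R_{gh}`. -/
structure GroupGrading (R : Type u) [NonUnitalRing R] (G : Type v) [Group G] where
  /-- the homogeneous component of degree `g` -/
  component : G → AddSubgroup R
  isInternal : ∀ [DecidableEq G], DirectSum.IsInternal component
  mul_mem : ∀ {g h : G} {x y : R}, x ∈ component g → y ∈ component h → x * y ∈ component (g * h)

namespace GroupGrading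

variable {R : Type u} [NonUnitalRing R] {G : Type v} [Group G]

/-- The homogeneous elements are the nonzero elements of the components. -/
def IsHomogeneous (𝒢 : GroupGrading R G) (x : R) : Prop :=
  x ≠ 0 ∧ ∃ g : G, x ∈ 𝒢.component g

/-- `R` is graded unit-regular: `R` is unital, with identity `e`, and every homogeneous `x` can be
written as `x = x u x`, where `u` is homogeneous and invertible in `R`. -/
def IsGradedUnitRegular (𝒢 : GroupGrading R G) : Prop :=
  ∃ e : R, (∀ x : R, e * x = x ∧ x * e = x) ∧
    ∀ x : R, 𝒢.IsHomogeneous x →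
      ∃ u : R, 𝒢.IsHomogeneous u ∧ (∃ t : R, u * t = e ∧ t * u = e) ∧ x = x * u * x

end GroupGrading

/-! ### Directed graphs -/

/-- A directed graph with vertex set `V`, edge set `E`, and source and range maps. -/
structure DirectedGraph (V : Type u) (E : Type v) where
  /-- the source map -/
  s : E → V
  /-- the range map -/
  r : E → V

/-- The graph consists of one vertex and one loop based on it. -/
def DirectedGraph.IsLoop {V : Type u} {E : Type v} (Γ : DirectedGraph V E) : Prop :=
  ∃ (a : V) (f : E), (∀ b : V, b = a) ∧ (∀ f' : E, f' = f) ∧ Γ.s f = a ∧ Γ.r f = a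

/-! ### Leavitt path algebras -/

/-- The generators `v` (`v ∈ E⁰`), `f` and `f*` (`f ∈ E¹`) of a Leavitt path algebra. -/
inductive LeavittGen (V : Type u) (E : Type v) : Type (max u v)
  | vert : V → LeavittGen V E
  | edge : E → LeavittGen V E
  | ghost : E → LeavittGen V E

/-- The free associative (non-unital) `K`-algebra on the symbols `v`, `f`, `f*`: it has the nonempty
words in these symbols as a `K`-basis. -/
abbrev LeavittFree (K : Type w) [Field K] (V : Type u) (E : Type v) : Type (max u v w) :=
  MonoidAlgebra K (FreeSemigroup (LeavittGen V E))

namespace LeavittFree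

variable (K : Type w) [Field K] {V : Type u} {E : Type v}

/-- A generator, as an element of the free algebra. -/
noncomputable def gen (x : LeavittGen V E) : LeavittFree K V E :=
  MonoidAlgebra.single (FreeSemigroup.of x) 1

/-- The symbol `v`. -/
noncomputable abbrev vert (a : V) : LeavittFree K V E := gen K (LeavittGen.vert a)

/-- The symbol `f`. -/
noncomputable abbrev edge (f : E) : LeavittFree K V E := gen K (LeavittGen.edge f)

/-- The symbol `f*`. -/
noncomputable abbrev ghost (f : E) : LeavittFree K V E := gen K (LeavittGen.ghost f)

end LeavittFree

open LeavittFree in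
/-- The defining relations of the Leavitt path algebra. -/
inductive LeavittRel (K : Type w) [Field K] {V : Type u} {E : Type v} (Γ : DirectedGraph V E) :
    LeavittFree K V E → LeavittFree K V E → Prop
  | vert_idem (a : V) : LeavittRel K Γ (vert K a * vert K a) (vert K a)
  | vert_orth (a b : V) (h : a ≠ b) : LeavittRel K Γ (vert K a * vert K b) 0
  | s_edge (f : E) : LeavittRel K Γ (vert K (Γ.s f) * edge K f) (edge K f)
  | edge_r (f : E) : LeavittRel K Γ (edge K f * vert K (Γ.r f)) (edge K f)
  | r_ghost (f : E) : LeavittRel K Γ (vert K (Γ.r f) * ghost K f) (ghost K f)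
  | ghost_s (f : E) : LeavittRel K Γ (ghost K f * vert K (Γ.s f)) (ghost K f)
  | ghost_edge_self (f : E) : LeavittRel K Γ (ghost K f * edge K f) (vert K (Γ.r f))
  | ghost_edge_ne (f f' : E) (h : f ≠ f') : LeavittRel K Γ (ghost K f * edge K f') 0
  | sum_edge_ghost (a : V) (hne : {f : E | Γ.s f = a}.Nonempty)
      (hfin : {f : E | Γ.s f = a}.Finite) :
      LeavittRel K Γ (vert K a) (∑ f ∈ hfin.toFinset, edge K f * ghost K f)

/-- The `K`-algebra congruence generated by the defining relations. -/
inductive LeavittCong (K : Type w) [Field K] {V : Type u} {E : Type v} (Γ : DirectedGraph V E) :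
    LeavittFree K V E → LeavittFree K V E → Prop
  | of {x y} (h : LeavittRel K Γ x y) : LeavittCong K Γ x y
  | refl (x) : LeavittCong K Γ x x
  | symm {x y} (h : LeavittCong K Γ x y) : LeavittCong K Γ y x
  | trans {x y z} (h : LeavittCong K Γ x y) (h' : LeavittCong K Γ y z) : LeavittCong K Γ x z
  | add {x y x' y'} (h : LeavittCong K Γ x y) (h' : LeavittCong K Γ x' y') :
      LeavittCong K Γ (x + x') (y + y')
  | mul {x y x' y'} (h : LeavittCong K Γ x y) (h' : LeavittCong K Γ x' y') :
      LeavittCong K Γ (x * x') (y * y')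
  | smul (c : K) {x y} (h : LeavittCong K Γ x y) : LeavittCong K Γ (c • x) (c • y)

/-- `LeavittCong` as a bundled ring congruence. -/
noncomputable def leavittCon (K : Type w) [Field K] {V : Type u} {E : Type v} (Γ : DirectedGraph V E) :
    RingCon (LeavittFree K V E) where
  r := LeavittCong K Γ
  iseqv := ⟨LeavittCong.refl, LeavittCong.symm, LeavittCong.trans⟩
  add' := LeavittCong.add
  mul' := LeavittCong.mul

/-- The Leavitt path algebra `L_K(E)` of a directed graph: the (not necessarily unital) associative
`K`-algebra presented by the generators `v`, `f`, `f*` and the relations `LeavittRel`. -/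
noncomputable def LeavittPathAlgebra (K : Type w) [Field K] {V : Type u} {E : Type v} (Γ : DirectedGraph V E) :
    Type (max u v w) :=
  (leavittCon K Γ).Quotient

namespace LeavittPathAlgebra

variable (K : Type w) [Field K] {V : Type u} {E : Type v} (Γ : DirectedGraph V E)

noncomputable instance instNonUnitalRing : NonUnitalRing (LeavittPathAlgebra K Γ) :=
  inferInstanceAs (NonUnitalRing (leavittCon K Γ).Quotient)

/-- The quotient map from the free algebra. -/
noncomputable def mk (x : LeavittFree K V E) : LeavittPathAlgebra K Γ :=
  (x : (leavittCon K Γ).Quotient)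

variable {K Γ}

theorem mk_surjective : Function.Surjective (mk K Γ) := fun x =>
  Quotient.inductionOn' x fun a => ⟨a, rfl⟩

theorem mk_eq_of_rel {x y : LeavittFree K V E} (h : LeavittRel K Γ x y) : mk K Γ x = mk K Γ y :=
  Quotient.sound' (LeavittCong.of h)

theorem mk_zero : mk K Γ 0 = 0 := rfl

theorem mk_add (x y : LeavittFree K V E) : mk K Γ (x + y) = mk K Γ x + mk K Γ y := rfl

theorem mk_mul (x y : LeavittFree K V E) : mk K Γ (x * y) = mk K Γ x * mk K Γ y := rfl

noncomputable instance instSMul : SMul K (LeavittPathAlgebra K Γ) where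
  smul c x := Quotient.map' (c • ·) (fun _ _ h => LeavittCong.smul c h) x

theorem mk_smul (c : K) (x : LeavittFree K V E) : mk K Γ (c • x) = c • mk K Γ x := rfl

noncomputable instance instModule : Module K (LeavittPathAlgebra K Γ) where
  one_smul x := by
    obtain ⟨x, rfl⟩ := mk_surjective x
    rw [← mk_smul, one_smul]
  mul_smul c d x := by
    obtain ⟨x, rfl⟩ := mk_surjective x
    rw [← mk_smul, ← mk_smul, ← mk_smul, mul_smul]
  smul_zero c := by rw [← mk_zero, ← mk_smul, smul_zero]
  smul_add c x y := by
    obtain ⟨x, rfl⟩ := mk_surjective x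
    obtain ⟨y, rfl⟩ := mk_surjective y
    rw [← mk_add, ← mk_smul, smul_add]; rfl
  add_smul c d x := by
    obtain ⟨x, rfl⟩ := mk_surjective x
    rw [← mk_smul, add_smul]; rfl
  zero_smul x := by
    obtain ⟨x, rfl⟩ := mk_surjective x
    rw [← mk_smul, zero_smul, mk_zero]

instance instIsScalarTower : IsScalarTower K (LeavittPathAlgebra K Γ) (LeavittPathAlgebra K Γ) where
  smul_assoc c x y := by
    obtain ⟨x, rfl⟩ := mk_surjective x
    obtain ⟨y, rfl⟩ := mk_surjective y
    simp only [smul_eq_mul, ← mk_smul, ← mk_mul, smul_mul_assoc]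

instance instSMulCommClass : SMulCommClass K (LeavittPathAlgebra K Γ) (LeavittPathAlgebra K Γ) where
  smul_comm c x y := by
    obtain ⟨x, rfl⟩ := mk_surjective x
    obtain ⟨y, rfl⟩ := mk_surjective y
    simp only [smul_eq_mul, ← mk_smul, ← mk_mul, mul_smul_comm]

variable (K Γ) in
/-- The quotient map, as a homomorphism of `K`-algebras. -/
noncomputable def mkHom : LeavittFree K V E →ₙₐ[K] LeavittPathAlgebra K Γ where
  toFun := mk K Γ
  map_smul' := mk_smul
  map_zero' := mk_zero
  map_add' := mk_add
  map_mul' := mk_mul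

/-- A homomorphism from the free algebra that respects the defining relations descends to the
Leavitt path algebra. -/
noncomputable def lift {B : Type*} [NonUnitalRing B] [Module K B] (φ : LeavittFree K V E →ₙₐ[K] B)
    (hφ : ∀ x y, LeavittRel K Γ x y → φ x = φ y) : LeavittPathAlgebra K Γ →ₙₐ[K] B :=
  have key : ∀ x y, LeavittCong K Γ x y → φ x = φ y := by
    intro x y h
    induction h with
    | of h => exact hφ _ _ h
    | refl => rfl
    | symm _ ih => exact ih.symm
    | trans _ _ ih ih' => exact ih.trans ih'
    | add _ _ ih ih' => rw [map_add, map_add, ih, ih']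
    | mul _ _ ih ih' => rw [map_mul, map_mul, ih, ih']
    | smul c _ ih => rw [map_smul, map_smul, ih]
  { toFun := fun x => Quotient.liftOn' x φ key
    map_smul' := fun c x => by
      obtain ⟨x, rfl⟩ := mk_surjective x
      exact map_smul φ c x
    map_zero' := map_zero φ
    map_add' := fun x y => by
      obtain ⟨x, rfl⟩ := mk_surjective x
      obtain ⟨y, rfl⟩ := mk_surjective y
      exact map_add φ x y
    map_mul' := fun x y => by
      obtain ⟨x, rfl⟩ := mk_surjective x
      obtain ⟨y, rfl⟩ := mk_surjective y
      exact map_mul φ x y }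

theorem lift_mk {B : Type*} [NonUnitalRing B] [Module K B] (φ : LeavittFree K V E →ₙₐ[K] B)
    (hφ : ∀ x y, LeavittRel K Γ x y → φ x = φ y) (x : LeavittFree K V E) :
    lift (Γ := Γ) φ hφ (mk K Γ x) = φ x := rfl

/-! ### The grading by the free group on the edges -/

/-- The degrees of the generators in the free group on the edges: `v` has degree `1`, `f` has degree
`f`, and `f*` has degree `f⁻¹`. -/
def genDegree : LeavittGen V E → FreeGroup E
  | .vert _ => 1
  | .edge f => FreeGroup.of f
  | .ghost f => (FreeGroup.of f)⁻¹

/-- The degree of a word: the product of the degrees of its letters. -/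
def degree : FreeSemigroup (LeavittGen V E) →ₙ* FreeGroup E := FreeSemigroup.lift genDegree

variable (K Γ) in
/-- The component of degree `g`: the `K`-linear span of the words of degree `g` in the generators. -/
noncomputable def component (g : FreeGroup E) : Submodule K (LeavittPathAlgebra K Γ) :=
  Submodule.span K {x | ∃ m : FreeSemigroup (LeavittGen V E),
    degree m = g ∧ x = mk K Γ (MonoidAlgebra.single m 1)}

theorem mk_single_mem (m : FreeSemigroup (LeavittGen V E)) :
    mk K Γ (MonoidAlgebra.single m 1) ∈ component K Γ (degree m) :=
  Submodule.subset_span ⟨m, rfl, rfl⟩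

theorem component_mul_mem {g h : FreeGroup E} {x y : LeavittPathAlgebra K Γ}
    (hx : x ∈ component K Γ g) (hy : y ∈ component K Γ h) : x * y ∈ component K Γ (g * h) := by
  induction hx using Submodule.span_induction with
  | mem x hx =>
    obtain ⟨m, rfl, rfl⟩ := hx
    induction hy using Submodule.span_induction with
    | mem y hy =>
      obtain ⟨n, rfl, rfl⟩ := hy
      rw [← mk_mul, MonoidAlgebra.single_mul_single, mul_one, ← map_mul]
      exact mk_single_mem _
    | zero => rw [mul_zero]; exact zero_mem _
    | add y z _ _ ihy ihz => rw [mul_add]; exact add_mem ihy ihz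
    | smul c y _ ih => rw [mul_smul_comm]; exact Submodule.smul_mem _ c ih
  | zero => rw [zero_mul]; exact zero_mem _
  | add y z _ _ ihy ihz => rw [add_mul]; exact add_mem ihy ihz
  | smul c y _ ih => rw [smul_mul_assoc]; exact Submodule.smul_mem _ c ih

theorem degree_of (x : LeavittGen V E) : degree (FreeSemigroup.of x) = genDegree x := rfl

variable (K Γ) in
/-- The coaction `m ↦ m ⊗ deg m` on words `m`. -/
noncomputable def preCoaction : LeavittFree K V E →ₙₐ[K]
    MonoidAlgebra (Unitization K (LeavittPathAlgebra K Γ)) (FreeGroup E) :=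
  MonoidAlgebra.liftMagma K
    { toFun := fun m => MonoidAlgebra.single (degree m)
        (Unitization.inr (mk K Γ (MonoidAlgebra.single m 1)))
      map_mul' := fun m n => by
        rw [MonoidAlgebra.single_mul_single, map_mul, ← Unitization.inr_mul, ← mk_mul,
          MonoidAlgebra.single_mul_single, mul_one] }

theorem preCoaction_single (m : FreeSemigroup (LeavittGen V E)) :
    preCoaction K Γ (MonoidAlgebra.single m 1) = MonoidAlgebra.single (degree m)
        (Unitization.inr (mk K Γ (MonoidAlgebra.single m 1))) := by
  simp [preCoaction]

theorem preCoaction_gen (x : LeavittGen V E) :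
    preCoaction K Γ (LeavittFree.gen K x) = MonoidAlgebra.single (genDegree x)
        (Unitization.inr (mk K Γ (LeavittFree.gen K x))) :=
  preCoaction_single _

theorem preCoaction_rel (x y : LeavittFree K V E) (h : LeavittRel K Γ x y) :
    preCoaction K Γ x = preCoaction K Γ y := by
  have hmk := mk_eq_of_rel h
  cases h with
  | sum_edge_ghost a hne hfin =>
    rw [map_sum]
    simp only [map_mul, preCoaction_gen, MonoidAlgebra.single_mul_single, ← Unitization.inr_mul,
      ← mk_mul, genDegree, mul_inv_cancel, hmk]
    change _ = ∑ f ∈ hfin.toFinset, MonoidAlgebra.singleAddHom (1 : FreeGroup E)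
      (Unitization.inrNonUnitalAlgHom K (LeavittPathAlgebra K Γ) (mkHom K Γ _))
    simp only [← map_sum]
    rfl
  | _ => simp [preCoaction_gen, MonoidAlgebra.single_mul_single, ← Unitization.inr_mul,
      ← mk_mul, genDegree, hmk, mk_zero]

variable (K Γ) in
/-- The coaction `x ↦ x ⊗ g` for `x` of degree `g`; its coefficients are the projections onto the
components. -/
noncomputable def coaction : LeavittPathAlgebra K Γ →ₙₐ[K]
    MonoidAlgebra (Unitization K (LeavittPathAlgebra K Γ)) (FreeGroup E) :=
  lift (preCoaction K Γ) preCoaction_rel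

theorem coaction_of_mem {g : FreeGroup E} {x : LeavittPathAlgebra K Γ}
    (hx : x ∈ component K Γ g) :
    coaction K Γ x = MonoidAlgebra.single g (Unitization.inr x) := by
  induction hx using Submodule.span_induction with
  | mem x hx =>
    obtain ⟨m, rfl, rfl⟩ := hx
    exact preCoaction_single m
  | zero => simp
  | add y z _ _ ihy ihz => rw [map_add, ihy, ihz, ← MonoidAlgebra.single_add, Unitization.inr_add]
  | smul c y _ ih => rw [map_smul, ih, MonoidAlgebra.smul_single, Unitization.inr_smul]

theorem component_sup : ⨆ g, component K Γ g = ⊤ := by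
  rw [eq_top_iff]
  rintro x -
  obtain ⟨x, rfl⟩ := mk_surjective x
  induction x using MonoidAlgebra.induction_linear with
  | zero => exact zero_mem _
  | add x y hx hy => exact add_mem hx hy
  | single m c =>
    rw [← mul_one c, ← smul_eq_mul, ← MonoidAlgebra.smul_single, mk_smul]
    exact Submodule.smul_mem _ c (Submodule.mem_iSup_of_mem _ (mk_single_mem m))

theorem component_isInternal [DecidableEq (FreeGroup E)] :
    DirectSum.IsInternal fun g => (component K Γ g).toAddSubgroup := by
  refine ⟨?_, ?_⟩
  · rw [injective_iff_map_eq_zero]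
    intro x hx
    have key : ∀ (g : FreeGroup E) (x : DirectSum (FreeGroup E) fun g => (component K Γ g).toAddSubgroup),
        (coaction K Γ (DirectSum.coeAddMonoidHom (fun g => (component K Γ g).toAddSubgroup) x)).coeff g =
          Unitization.inr (x g : LeavittPathAlgebra K Γ) := by
      intro g x
      induction x using DirectSum.induction_on with
      | zero => simp
      | of i y =>
        rw [DirectSum.coeAddMonoidHom_of, coaction_of_mem y.2]
        by_cases h : i = g
        · subst h; simp
        · simp [h, DirectSum.of_eq_of_ne _ _ _ (Ne.symm h)]
      | add x y hx hy => simp [hx, hy]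
    ext g
    have := key g x
    rw [hx, map_zero] at this
    have h0 : (Unitization.inr (x g : LeavittPathAlgebra K Γ) :
        Unitization K (LeavittPathAlgebra K Γ)) = Unitization.inr 0 := by
      rw [← this]; simp
    simpa using Unitization.inr_injective h0
  · intro x
    have hx : x ∈ ⨆ g, component K Γ g := by rw [component_sup]; trivial
    induction hx using Submodule.iSup_induction' with
    | mem i x hx => exact ⟨DirectSum.of _ i ⟨x, hx⟩, DirectSum.coeAddMonoidHom_of ..⟩
    | zero => exact ⟨0, map_zero _⟩
    | add x y _ _ hx hy =>
      obtain ⟨a, rfl⟩ := hx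
      obtain ⟨b, rfl⟩ := hy
      exact ⟨a + b, map_add ..⟩

variable (K Γ) in
/-- The `𝔽`-grading of the Leavitt path algebra, `𝔽` the free group on the edges. The canonical
isomorphism onto the partial skew group ring `D(X) ⋆ 𝔽`, `v ↦ 1_v δ_1`, `f ↦ 1_f δ_f`,
`f* ↦ 1_{f⁻¹} δ_{f⁻¹}`, identifies this component of degree `g` with `D_g δ_g`: it sends the
spanning words of degree `g` into `D_g δ_g`, and both families are direct sum decompositions. -/
noncomputable def freeGroupGrading : GroupGrading (LeavittPathAlgebra K Γ) (FreeGroup E) where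
  component g := (component K Γ g).toAddSubgroup
  isInternal := component_isInternal (K := K) (Γ := Γ)
  mul_mem := component_mul_mem

/-- Every grading of the `K`-algebra `L_K(E)` in which `v`, `f`, `f*` have degrees `1`, `f`, `f⁻¹`
is the grading above. -/
theorem component_eq_of_gen_mem (𝒢 : GroupGrading (LeavittPathAlgebra K Γ) (FreeGroup E))
    (hsmul : ∀ (c : K) (g : FreeGroup E) (x), x ∈ 𝒢.component g → c • x ∈ 𝒢.component g)
    (hgen : ∀ x : LeavittGen V E, mk K Γ (LeavittFree.gen K x) ∈ 𝒢.component (genDegree x)) :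
    𝒢.component = (freeGroupGrading K Γ).component := by
  classical
  have hword : ∀ m : FreeSemigroup (LeavittGen V E),
      mk K Γ (MonoidAlgebra.single m 1) ∈ 𝒢.component (degree m) := by
    intro m
    induction m using FreeSemigroup.recOnMul with
    | ih1 x => exact hgen x
    | ih2 x y hx hy =>
      rw [map_mul, ← mul_one (1 : K), ← MonoidAlgebra.single_mul_single, mk_mul]
      exact 𝒢.mul_mem hx hy
  have hle : ∀ g, (freeGroupGrading K Γ).component g ≤ 𝒢.component g := by
    intro g x hx
    change x ∈ component K Γ g at hx
    induction hx using Submodule.span_induction with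
    | mem x hx => obtain ⟨m, rfl, rfl⟩ := hx; exact hword m
    | zero => exact zero_mem _
    | add y z _ _ ihy ihz => exact add_mem ihy ihz
    | smul c y _ ih => exact hsmul c g y ih
  funext g
  refine le_antisymm (fun x hx => ?_) (hle g)
  obtain ⟨d, hd⟩ := (freeGroupGrading K Γ).isInternal.2 x
  let d' : DirectSum (FreeGroup E) fun g => 𝒢.component g :=
    DirectSum.map (fun g => AddSubgroup.inclusion (hle g)) d
  have hd' : DirectSum.coeAddMonoidHom 𝒢.component d' = x := by
    rw [← hd]
    simp only [d']
    generalize d = e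
    induction e using DirectSum.induction_on with
    | zero => simp
    | of i y => rw [DirectSum.map_of, DirectSum.coeAddMonoidHom_of, DirectSum.coeAddMonoidHom_of]; rfl
    | add x y hx hy => rw [map_add, map_add, map_add, hx, hy]
  have he : d' = DirectSum.of (fun g => 𝒢.component g) g ⟨x, hx⟩ :=
    𝒢.isInternal.1 (hd'.trans
      (DirectSum.coeAddMonoidHom_of 𝒢.component g ⟨x, hx⟩).symm)
  have hdx : d = DirectSum.of (fun g => (freeGroupGrading K Γ).component g) g (d g) := by
    refine DFinsupp.ext fun h => ?_
    by_cases hh : h = g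
    · subst hh; rw [DirectSum.of_eq_same]
    · rw [DirectSum.of_eq_of_ne _ _ _ hh]
      have h1 : d' h = 0 := by rw [he, DirectSum.of_eq_of_ne _ _ _ hh]
      have h2 : ((d' h : 𝒢.component h) : LeavittPathAlgebra K Γ) = d h := by
        simp only [d', DirectSum.map_apply, AddSubgroup.coe_inclusion]
      exact Subtype.ext (by rw [← h2, h1]; rfl)
  rw [← hd, hdx, DirectSum.coeAddMonoidHom_of]
  exact (d g).2

end LeavittPathAlgebra

/-! If `f = f u f` with `u` homogeneous and invertible, then `u` has degree `f⁻¹`, because a nonzero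
element lies in only one component. Every word in the generators is zero or a monomial `α w β*` with
the degree of the word. If that degree is `f⁻¹`, then `β = fα` in the free group, hence as lists of
edges, because positive words are reduced. So each such monomial ends in `f*`, and `u f f* = u`
(`mul_edge_mul_ghost_of_mem`). Cancelling `u` on the left gives `f f* = e` for every edge `f`.
Therefore `s(f) = e`, which is orthogonal to any other vertex, and `f' = f f* f' = 0` for any edge
`f' ≠ f`.

These are contradictions only once vertices and edges are known to be nonzero in an algebra given by
a presentation. This comes from a representation on functions `V × I → K`, in which edges act
through partial injections (`vert_ne_zero`).

Conversely, over a loop `f f* = f* f = e`. So `f` is a unit, each component is a line spanned by a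
unit, and the inverse of a homogeneous `x` serves as `u`. -/

namespace LeavittPathAlgebra

variable {K : Type w} [Field K] {V : Type u} {E : Type v} {Γ : DirectedGraph V E}

variable (K Γ) in
/-- The class of a generator in the Leavitt path algebra. -/
noncomputable def gen (x : LeavittGen V E) : LeavittPathAlgebra K Γ := mk K Γ (LeavittFree.gen K x)

variable (K Γ) in
/-- The idempotent of a vertex. -/
noncomputable abbrev vert (a : V) : LeavittPathAlgebra K Γ := gen K Γ (.vert a)

variable (K Γ) in
/-- The element `f` of an edge. -/
noncomputable abbrev edge (f : E) : LeavittPathAlgebra K Γ := gen K Γ (.edge f)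

variable (K Γ) in
/-- The element `f*` of an edge. -/
noncomputable abbrev ghost (f : E) : LeavittPathAlgebra K Γ := gen K Γ (.ghost f)

theorem vert_mul_self (a : V) : vert K Γ a * vert K Γ a = vert K Γ a :=
  mk_eq_of_rel (.vert_idem a)

theorem vert_mul_vert_of_ne {a b : V} (h : a ≠ b) : vert K Γ a * vert K Γ b = 0 :=
  mk_eq_of_rel (.vert_orth a b h)

theorem s_mul_edge (f : E) : vert K Γ (Γ.s f) * edge K Γ f = edge K Γ f :=
  mk_eq_of_rel (.s_edge f)

theorem edge_mul_r (f : E) : edge K Γ f * vert K Γ (Γ.r f) = edge K Γ f :=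
  mk_eq_of_rel (.edge_r f)

theorem r_mul_ghost (f : E) : vert K Γ (Γ.r f) * ghost K Γ f = ghost K Γ f :=
  mk_eq_of_rel (.r_ghost f)

theorem ghost_mul_s (f : E) : ghost K Γ f * vert K Γ (Γ.s f) = ghost K Γ f :=
  mk_eq_of_rel (.ghost_s f)

theorem ghost_mul_edge_self (f : E) : ghost K Γ f * edge K Γ f = vert K Γ (Γ.r f) :=
  mk_eq_of_rel (.ghost_edge_self f)

theorem ghost_mul_edge_of_ne {f f' : E} (h : f ≠ f') : ghost K Γ f * edge K Γ f' = 0 :=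
  mk_eq_of_rel (.ghost_edge_ne f f' h)

theorem vert_eq_sum (a : V) (hne : {f : E | Γ.s f = a}.Nonempty)
    (hfin : {f : E | Γ.s f = a}.Finite) :
    vert K Γ a = ∑ f ∈ hfin.toFinset, edge K Γ f * ghost K Γ f := by
  refine (mk_eq_of_rel (.sum_edge_ghost a hne hfin)).trans ?_
  exact map_sum (mkHom K Γ) _ _

theorem gen_mem_component (x : LeavittGen V E) : gen K Γ x ∈ component K Γ (genDegree x) :=
  mk_single_mem (FreeSemigroup.of x)

theorem mk_single_of (x : LeavittGen V E) :
    mk K Γ (MonoidAlgebra.single (FreeSemigroup.of x) 1) = gen K Γ x := rfl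

theorem mk_single_mul (m n : FreeSemigroup (LeavittGen V E)) :
    mk K Γ (MonoidAlgebra.single (m * n) 1) =
      mk K Γ (MonoidAlgebra.single m 1) * mk K Γ (MonoidAlgebra.single n 1) := by
  rw [← mk_mul, MonoidAlgebra.single_mul_single, mul_one]

/-- The coaction of `x` is supported at each degree that `x` has. -/
theorem degree_unique {g h : FreeGroup E} {x : LeavittPathAlgebra K Γ} (hx : x ≠ 0)
    (hg : x ∈ component K Γ g) (hh : x ∈ component K Γ h) : g = h := by
  have key := (coaction_of_mem hg).symm.trans (coaction_of_mem hh)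
  by_contra hne
  have h1 := congrArg (fun y => y.coeff g) key
  have h2 : (Unitization.inr x : Unitization K (LeavittPathAlgebra K Γ)) = Unitization.inr 0 := by
    simpa [Ne.symm hne] using h1
  exact hx (Unitization.inr_injective h2)

/-! ### A faithful-on-vertices representation -/

/-- Data representing the edges of a graph as partial injections of `V × I`: the edge `f` maps
`(r f, i)` to `(s f, push f i)`, and `(v, i)` is the image of `(r (head v i), tail v i)` whenever
`v` emits an edge. -/
structure BranchingSystem (Γ : DirectedGraph V E) (I : Type*) where
  /-- the action of the edges on the second coordinate -/
  push : E → I → I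
  /-- the edge whose range contains the given point -/
  head : V → I → E
  /-- the second coordinate of the preimage of the given point -/
  tail : V → I → I
  head_push : ∀ f i, head (Γ.s f) (push f i) = f
  tail_push : ∀ f i, tail (Γ.s f) (push f i) = i
  s_head : ∀ f i, Γ.s (head (Γ.s f) i) = Γ.s f
  push_tail : ∀ f i, push (head (Γ.s f) i) (tail (Γ.s f) i) = i

/-- The set `I = ℕ ⊕ E` is infinite and at least as large as `s⁻¹(a)`, so `s⁻¹(a) × I ≃ I` whenever
`a` emits an edge. Such a bijection is `push`; the components of its inverse are `head` and `tail`.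
-/
theorem exists_branchingSystem (Γ : DirectedGraph V E) [Nonempty E] :
    Nonempty (BranchingSystem Γ (ℕ ⊕ E)) := by
  classical
  have hequiv : ∀ a : V, Nonempty {f : E // Γ.s f = a} →
      Nonempty ({f : E // Γ.s f = a} × (ℕ ⊕ E) ≃ ℕ ⊕ E) := by
    intro a ha
    have hle : Cardinal.mk {f : E // Γ.s f = a} ≤ Cardinal.mk (ℕ ⊕ E) :=
      Cardinal.mk_le_of_injective (f := fun f => Sum.inr f.1)
        fun f f' h => Subtype.ext (Sum.inr_injective h)
    refine Cardinal.eq.1 ?_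
    rw [← Cardinal.mul_def]
    exact Cardinal.mul_eq_right (Cardinal.aleph0_le_mk _) hle
      (Cardinal.mk_ne_zero _)
  have e : ∀ a : V, Nonempty {f : E // Γ.s f = a} →
      ({f : E // Γ.s f = a} × (ℕ ⊕ E) ≃ ℕ ⊕ E) := fun a ha => (hequiv a ha).some
  have hne : ∀ f, Nonempty {f' : E // Γ.s f' = Γ.s f} := fun f => ⟨⟨f, rfl⟩⟩
  refine ⟨{
    push := fun f i => e (Γ.s f) (hne f) (⟨f, rfl⟩, i)
    -- At vertices emitting no edge the values are arbitrary: the axioms only involve vertices of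
    -- the form `Γ.s f`.
    head := fun a i => if h : Nonempty {f : E // Γ.s f = a} then ((e a h).symm i).1.1
      else Classical.arbitrary E
    tail := fun a i => if h : Nonempty {f : E // Γ.s f = a} then ((e a h).symm i).2 else i
    head_push := fun f i => by simp [hne f]
    tail_push := fun f i => by simp [hne f]
    s_head := fun f i => by simpa [hne f] using ((e _ (hne f)).symm i).1.2
    push_tail := fun f i => ?_ }⟩
  -- The source of the head edge equals `Γ.s f` only propositionally, so the bijections at the two
  -- vertices are compared with the vertex generalized.
  have key : ∀ (a : V) (ha : Nonempty {f : E // Γ.s f = a}) (p : {f : E // Γ.s f = a} × (ℕ ⊕ E))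
      (f' : E) (i' : ℕ ⊕ E), f' = p.1.1 → i' = p.2 →
      e (Γ.s f') (hne f') (⟨f', rfl⟩, i') = e a ha p := by
    rintro a ha ⟨⟨f, rfl⟩, i⟩ _ _ rfl rfl
    rfl
  exact (key _ (hne f) ((e _ (hne f)).symm i) _ _ (dif_pos (hne f)) (dif_pos (hne f))).trans
    (Equiv.apply_symm_apply _ _)

namespace BranchingSystem

variable {I : Type*} (b : BranchingSystem Γ I)

open Classical in
variable (K) in
/-- The operators of the generators on the functions `V × I → K`. -/
noncomputable def genOp : LeavittGen V E → Module.End K (V → I → K)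
  | .vert a =>
    { toFun := fun φ w i => if w = a then φ w i else 0
      map_add' := fun φ ψ => by ext w i; by_cases h : w = a <;> simp [h]
      map_smul' := fun c φ => by ext w i; by_cases h : w = a <;> simp [h] }
  | .edge f =>
    { toFun := fun φ w i => if w = Γ.s f ∧ b.head w i = f then φ (Γ.r f) (b.tail w i) else 0
      map_add' := fun φ ψ => by
        ext w i
        simp only [Pi.add_apply]
        split_ifs <;> simp
      map_smul' := fun c φ => by
        ext w i
        simp only [Pi.smul_apply, RingHom.id_apply]
        split_ifs <;> simp }
  | .ghost f =>
    { toFun := fun φ w i => if w = Γ.r f then φ (Γ.s f) (b.push f i) else 0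
      map_add' := fun φ ψ => by ext w i; by_cases h : w = Γ.r f <;> simp [h]
      map_smul' := fun c φ => by ext w i; by_cases h : w = Γ.r f <;> simp [h] }

open Classical in
theorem genOp_vert (a : V) (φ : V → I → K) (w : V) (i : I) :
    b.genOp K (.vert a) φ w i = if w = a then φ w i else 0 := rfl

open Classical in
theorem genOp_edge (f : E) (φ : V → I → K) (w : V) (i : I) :
    b.genOp K (.edge f) φ w i =
      if w = Γ.s f ∧ b.head w i = f then φ (Γ.r f) (b.tail w i) else 0 := rfl

open Classical in
theorem genOp_ghost (f : E) (φ : V → I → K) (w : V) (i : I) :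
    b.genOp K (.ghost f) φ w i = if w = Γ.r f then φ (Γ.s f) (b.push f i) else 0 := rfl

variable (K) in
/-- The operators of the elements of the free algebra. -/
noncomputable def freeOp : LeavittFree K V E →ₙₐ[K] Module.End K (V → I → K) :=
  MonoidAlgebra.liftMagma K (FreeSemigroup.lift (b.genOp K))

theorem freeOp_gen (x : LeavittGen V E) : b.freeOp K (LeavittFree.gen K x) = b.genOp K x := by
  simp [freeOp, LeavittFree.gen]

theorem freeOp_rel (x y : LeavittFree K V E) (h : LeavittRel K Γ x y) :
    b.freeOp K x = b.freeOp K y := by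
  classical
  cases h with
  | vert_idem a =>
    simp only [map_mul, freeOp_gen]
    ext φ w i
    simp only [Module.End.mul_apply, genOp_vert]
    grind
  | vert_orth a a' h =>
    simp only [map_mul, freeOp_gen, map_zero]
    ext φ w i
    simp only [Module.End.mul_apply, genOp_vert, LinearMap.zero_apply, Pi.zero_apply]
    grind
  | s_edge f =>
    simp only [map_mul, freeOp_gen]
    ext φ w i
    simp only [Module.End.mul_apply, genOp_vert, genOp_edge]
    grind
  | edge_r f =>
    simp only [map_mul, freeOp_gen]
    ext φ w i
    simp only [Module.End.mul_apply, genOp_vert, genOp_edge, if_true]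
  | r_ghost f =>
    simp only [map_mul, freeOp_gen]
    ext φ w i
    simp only [Module.End.mul_apply, genOp_vert, genOp_ghost]
    grind
  | ghost_s f =>
    simp only [map_mul, freeOp_gen]
    ext φ w i
    simp only [Module.End.mul_apply, genOp_vert, genOp_ghost, if_true]
  | ghost_edge_self f =>
    simp only [map_mul, freeOp_gen]
    ext φ w i
    simp only [Module.End.mul_apply, genOp_vert, genOp_edge, genOp_ghost, b.head_push,
      b.tail_push, and_self, if_true]
    grind
  | ghost_edge_ne f f' h =>
    simp only [map_mul, freeOp_gen, map_zero]
    ext φ w i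
    simp only [Module.End.mul_apply, genOp_edge, genOp_ghost, b.head_push, h, and_false,
      if_false, ite_self, LinearMap.zero_apply, Pi.zero_apply]
  | sum_edge_ghost a hne hfin =>
    obtain ⟨f₀, rfl⟩ := hne
    rw [map_sum]
    simp only [map_mul, freeOp_gen]
    ext φ w i
    simp only [LinearMap.sum_apply, Finset.sum_apply, Module.End.mul_apply, genOp_vert,
      genOp_edge, genOp_ghost, if_true]
    by_cases hw : w = Γ.s f₀
    · subst hw
      -- The ranges of the edges leaving `Γ.s f₀` partition its fibre, so only the edge whose range
      -- contains the point contributes.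
      rw [if_pos rfl, Finset.sum_eq_single (b.head (Γ.s f₀) i)]
      · rw [if_pos ⟨(b.s_head f₀ i).symm, rfl⟩, b.s_head, b.push_tail]
      · rintro f - hf
        rw [if_neg fun h => hf h.2.symm]
      · intro h
        exact absurd (hfin.mem_toFinset.2 (b.s_head f₀ i)) h
    · rw [if_neg hw, Finset.sum_eq_zero]
      intro f hf
      rw [if_neg fun h => hw (h.1.trans (hfin.mem_toFinset.1 hf))]

end BranchingSystem

/-- The operator of `a` restricts functions to the nonempty set `{a} × I`, so it does not kill the
constant function `1`. -/
theorem vert_ne_zero [Nonempty E] (a : V) : vert K Γ a ≠ 0 := by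
  obtain ⟨b⟩ := exists_branchingSystem Γ
  intro h
  have h1 : b.genOp K (.vert a) = 0 := by
    rw [← b.freeOp_gen, ← lift_mk (Γ := Γ) (b.freeOp K) b.freeOp_rel]
    exact (congrArg _ h).trans (map_zero _)
  have h2 := b.genOp_vert (K := K) a (fun _ _ => 1) a (Sum.inl 0)
  rw [h1] at h2
  simp at h2

theorem edge_ne_zero (f : E) : edge K Γ f ≠ 0 := by
  have : Nonempty E := ⟨f⟩
  intro h
  have h1 := ghost_mul_edge_self (K := K) (Γ := Γ) f
  rw [h, mul_zero] at h1
  exact vert_ne_zero _ h1.symm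

/-! ### Monomials -/

variable (K Γ) in
/-- The element `w β*`, for a vertex `w` and a list `β` of edges. -/
noncomputable def ghostMonomial (w : V) : List E → LeavittPathAlgebra K Γ
  | [] => vert K Γ w
  | f :: β => ghostMonomial w β * ghost K Γ f

variable (K Γ) in
/-- The element `α w β*`, for a vertex `w` and lists `α`, `β` of edges. -/
noncomputable def monomial (w : V) (β : List E) : List E → LeavittPathAlgebra K Γ
  | [] => ghostMonomial K Γ w β
  | f :: α => edge K Γ f * monomial w β α

/-- The degree of a list of edges. -/
def listDegree (α : List E) : FreeGroup E := (α.map FreeGroup.of).prod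

theorem listDegree_eq_mk (α : List E) :
    listDegree α = FreeGroup.mk (α.map fun f => (f, true)) := by
  induction α with
  | nil => rfl
  | cons f α ih =>
    rw [listDegree, List.map_cons, List.prod_cons, ← listDegree, ih]
    rfl

/-- A positive word has no cancellation, so it is its own reduced form and can be read off from the
group element. -/
theorem listDegree_injective : Function.Injective (listDegree (E := E)) := by
  classical
  have hred : ∀ α : List E, (listDegree α).toWord = α.map fun f => (f, true) := by
    intro α
    rw [listDegree_eq_mk, FreeGroup.toWord_mk]
    induction α with
    | nil => rfl
    | cons f α ih =>
      rw [List.map_cons, FreeGroup.reduce.cons, ih]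
      cases α <;> simp
  intro α β h
  have h1 := (hred α).symm.trans ((congrArg FreeGroup.toWord h).trans (hred β))
  exact List.map_injective_iff.2 (fun f f' h => (Prod.ext_iff.1 h).1) h1

theorem vert_mul_ghostMonomial_self (w : V) (β : List E) :
    vert K Γ w * ghostMonomial K Γ w β = ghostMonomial K Γ w β := by
  induction β with
  | nil => exact vert_mul_self w
  | cons f β ih => rw [ghostMonomial, ← mul_assoc, ih]

theorem vert_mul_ghostMonomial_of_ne {a w : V} (h : a ≠ w) (β : List E) :
    vert K Γ a * ghostMonomial K Γ w β = 0 := by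
  rw [← vert_mul_ghostMonomial_self, ← mul_assoc, vert_mul_vert_of_ne h, zero_mul]

/-- The head of `β` is the rightmost ghost factor, so a new ghost on the left goes to the end of the
list. -/
theorem ghost_mul_ghostMonomial (f : E) (β : List E) :
    ghost K Γ f * ghostMonomial K Γ (Γ.s f) β = ghostMonomial K Γ (Γ.r f) (β ++ [f]) := by
  induction β with
  | nil => exact (ghost_mul_s f).trans (r_mul_ghost f).symm
  | cons f' β ih => rw [ghostMonomial, ← mul_assoc, ih]; rfl

/-- A monomial is fixed on the left by one vertex, `w` or the source of its first edge, and all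
other vertices are orthogonal to that one. -/
theorem vert_mul_monomial (a w : V) (β α : List E) :
    vert K Γ a * monomial K Γ w β α = 0 ∨
      vert K Γ a * monomial K Γ w β α = monomial K Γ w β α := by
  cases α with
  | nil =>
    by_cases h : a = w
    · subst h; exact .inr (vert_mul_ghostMonomial_self a β)
    · exact .inl (vert_mul_ghostMonomial_of_ne h β)
  | cons f α =>
    rw [monomial, ← mul_assoc]
    by_cases h : a = Γ.s f
    · subst h; rw [s_mul_edge]; exact .inr rfl
    · rw [← s_mul_edge, ← mul_assoc, vert_mul_vert_of_ne h, zero_mul, zero_mul]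
      exact .inl rfl

/-- A monomial `α w β*` multiplied on the left by a generator is zero or a monomial. -/
theorem gen_mul_monomial (x : LeavittGen V E) (w : V) (β α : List E) :
    gen K Γ x * monomial K Γ w β α = 0 ∨ ∃ w' β' α',
      gen K Γ x * monomial K Γ w β α = monomial K Γ w' β' α' ∧
        genDegree x * (listDegree α * (listDegree β)⁻¹) =
          listDegree α' * (listDegree β')⁻¹ := by
  cases x with
  | vert a =>
    refine (vert_mul_monomial a w β α).imp_right fun h => ⟨w, β, α, h, ?_⟩
    simp [genDegree]
  | edge f => exact .inr ⟨w, β, f :: α, rfl, by simp [genDegree, listDegree, mul_assoc]⟩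
  | ghost f =>
    cases α with
    | nil =>
      by_cases h : Γ.s f = w
      · subst h
        exact .inr ⟨Γ.r f, β ++ [f], [], ghost_mul_ghostMonomial f β,
          by simp [genDegree, listDegree]⟩
      · refine .inl ?_
        rw [monomial, ← ghost, ← ghost_mul_s f, mul_assoc, vert_mul_ghostMonomial_of_ne h, mul_zero]
    | cons f' α =>
      rw [monomial, ← mul_assoc]
      by_cases h : f = f'
      · subst h
        rw [ghost_mul_edge_self]
        refine (vert_mul_monomial (Γ.r f) w β α).imp_right fun h => ⟨w, β, α, h, ?_⟩
        simp [genDegree, listDegree, mul_assoc]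
      · rw [ghost_mul_edge_of_ne h, zero_mul]
        exact .inl rfl

theorem gen_eq_monomial (x : LeavittGen V E) :
    ∃ w β α, gen K Γ x = monomial K Γ w β α ∧
      genDegree x = listDegree α * (listDegree β)⁻¹ := by
  cases x with
  | vert a => exact ⟨a, [], [], rfl, by simp [genDegree, listDegree]⟩
  | edge f => exact ⟨Γ.r f, [], [f], (edge_mul_r f).symm, by simp [genDegree, listDegree]⟩
  | ghost f => exact ⟨Γ.r f, [f], [], (r_mul_ghost f).symm, by simp [genDegree, listDegree]⟩

/-- Every word in the generators is zero or a monomial of the same degree. -/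
theorem word_eq_monomial (m : FreeSemigroup (LeavittGen V E)) :
    mk K Γ (MonoidAlgebra.single m 1) = 0 ∨ ∃ w β α,
      mk K Γ (MonoidAlgebra.single m 1) = monomial K Γ w β α ∧
        degree m = listDegree α * (listDegree β)⁻¹ := by
  induction m using FreeSemigroup.recOnMul with
  | ih1 x => exact .inr (gen_eq_monomial x)
  | ih2 x m _ ih =>
    rw [mk_single_mul, map_mul, mk_single_of, degree_of]
    rcases ih with h | ⟨w, β, α, h, hd⟩
    · rw [h, mul_zero]; exact .inl rfl
    · rw [h, hd]; exact gen_mul_monomial x w β α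

theorem monomial_cons_right (w : V) (f : E) (β α : List E) :
    monomial K Γ w (f :: β) α = monomial K Γ w β α * ghost K Γ f := by
  induction α with
  | nil => rfl
  | cons f' α ih => rw [monomial, ih, monomial, mul_assoc]

/-- The component of degree `f⁻¹` is contained in the left ideal generated by `f*`. -/
theorem mul_edge_mul_ghost_of_mem {f : E} {x : LeavittPathAlgebra K Γ}
    (hx : x ∈ component K Γ (FreeGroup.of f)⁻¹) : x * (edge K Γ f * ghost K Γ f) = x := by
  induction hx using Submodule.span_induction with
  | mem x hx =>
    obtain ⟨m, hm, rfl⟩ := hx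
    rcases word_eq_monomial (K := K) (Γ := Γ) m with h | ⟨w, β, α, h, hd⟩
    · rw [h, zero_mul]
    · obtain rfl : f :: α = β := by
        apply listDegree_injective
        rw [hm, eq_mul_inv_iff_mul_eq, inv_mul_eq_iff_eq_mul] at hd
        rw [hd]
        simp [listDegree]
      rw [h, monomial_cons_right, mul_assoc, ← mul_assoc (ghost K Γ f), ghost_mul_edge_self,
        r_mul_ghost]
  | zero => exact zero_mul _
  | add x y _ _ hx hy => rw [add_mul, hx, hy]
  | smul c x _ hx => rw [smul_mul_assoc, hx]

/-! ### Graded unit-regularity forces a loop -/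

theorem isLoop_of_isGradedUnitRegular [Nonempty E]
    (h : (freeGroupGrading K Γ).IsGradedUnitRegular) : Γ.IsLoop := by
  obtain ⟨e, he, hreg⟩ := h
  have key : ∀ f : E, ∃ u t : LeavittPathAlgebra K Γ,
      u * (edge K Γ f * ghost K Γ f) = u ∧ t * u = e := by
    intro f
    have hf : edge K Γ f ∈ component K Γ (FreeGroup.of f) := gen_mem_component (.edge f)
    obtain ⟨u, ⟨-, g, hu⟩, ⟨t, -, htu⟩, hfuf⟩ := hreg (edge K Γ f) ⟨edge_ne_zero f, _, hf⟩
    replace hu : u ∈ component K Γ g := hu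
    have hmem := component_mul_mem (component_mul_mem hf hu) hf
    rw [← hfuf] at hmem
    -- Comparing degrees in `f = f u f` gives `f = f g f`, hence `g = f⁻¹`.
    have hg := degree_unique (edge_ne_zero f) hf hmem
    obtain rfl : g = (FreeGroup.of f)⁻¹ := by
      rw [eq_comm, mul_eq_right] at hg
      exact eq_inv_of_mul_eq_one_right hg
    exact ⟨u, t, mul_edge_mul_ghost_of_mem hu, htu⟩
  have hs : ∀ f : E, vert K Γ (Γ.s f) = e := by
    intro f
    obtain ⟨u, t, hu, htu⟩ := key f
    have h1 : u * vert K Γ (Γ.s f) = u := by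
      rw [← hu, mul_assoc, mul_assoc, ghost_mul_s]
    -- Since `u s(f) = u`, the left inverse `t` gives `s(f) = t u s(f) = t u = e`.
    rw [← (he (vert K Γ (Γ.s f))).1, ← htu, mul_assoc, h1]
  obtain ⟨f⟩ := ‹Nonempty E›
  have hV : ∀ a : V, a = Γ.s f := by
    intro a
    by_contra ha
    have : Nonempty E := ⟨f⟩
    apply vert_ne_zero (K := K) (Γ := Γ) a
    rw [← (he (vert K Γ a)).2, ← hs f, vert_mul_vert_of_ne ha]
  refine ⟨Γ.s f, f, hV, fun f' => ?_, rfl, hV _⟩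
  by_contra hne
  obtain ⟨u, t, hu, htu⟩ := key f
  apply edge_ne_zero (K := K) (Γ := Γ) f'
  -- Here `f' = t u f' = t u f f* f' = 0`.
  rw [← (he (edge K Γ f')).1, ← htu, mul_assoc, ← hu, mul_assoc, mul_assoc,
    ghost_mul_edge_of_ne (Ne.symm hne), mul_zero, mul_zero, mul_zero]

/-! ### The Leavitt path algebra of a loop -/

theorem isGradedUnitRegular_of_isLoop (h : Γ.IsLoop) :
    (freeGroupGrading K Γ).IsGradedUnitRegular := by
  obtain ⟨a, f, hV, hE, hs, hr⟩ := h
  set e := vert K Γ a with he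
  have hgf : ghost K Γ f * edge K Γ f = e := by rw [ghost_mul_edge_self, hr]
  -- The only vertex emits exactly one edge, so the summation relation has a single term.
  have hfg : edge K Γ f * ghost K Γ f = e := by
    have hfin : {f' : E | Γ.s f' = a}.Finite := (Set.finite_singleton f).subset fun f' _ => hE f'
    have hset : hfin.toFinset = {f} := by
      ext f'
      simp only [Set.Finite.mem_toFinset, Set.mem_ofPred_eq, Finset.mem_singleton]
      exact ⟨fun _ => hE f', fun h => h ▸ hs⟩
    rw [he, vert_eq_sum a ⟨f, hs⟩ hfin, hset, Finset.sum_singleton]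
  have hegen : ∀ x : LeavittGen V E, e * gen K Γ x = gen K Γ x ∧ gen K Γ x * e = gen K Γ x := by
    rintro (b | f' | f')
    · rw [hV b]; exact ⟨vert_mul_self a, vert_mul_self a⟩
    · rw [hE f']
      exact ⟨by rw [he, ← hs, s_mul_edge], by rw [he, ← hr, edge_mul_r]⟩
    · rw [hE f']
      exact ⟨by rw [he, ← hr, r_mul_ghost], by rw [he, ← hs, ghost_mul_s]⟩
  have hone : ∀ x : LeavittPathAlgebra K Γ, e * x = x ∧ x * e = x := by
    intro x
    have hx : x ∈ ⨆ g, component K Γ g := by rw [component_sup]; trivial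
    induction hx using Submodule.iSup_induction' with
    | mem g x hx =>
      induction hx using Submodule.span_induction with
      | mem x hx =>
        obtain ⟨m, -, rfl⟩ := hx
        induction m using FreeSemigroup.recOnMul with
        | ih1 x => exact hegen x
        | ih2 x m h1 h2 =>
          rw [mk_single_mul]
          exact ⟨by rw [← mul_assoc, h1.1], by rw [mul_assoc, h2.2]⟩
      | zero => simp
      | add x y _ _ hx hy => exact ⟨by rw [mul_add, hx.1, hy.1], by rw [add_mul, hx.2, hy.2]⟩
      | smul c x _ hx => exact ⟨by rw [mul_smul_comm, hx.1], by rw [smul_mul_assoc, hx.2]⟩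
    | zero => simp
    | add x y _ _ hx hy => exact ⟨by rw [mul_add, hx.1, hy.1], by rw [add_mul, hx.2, hy.2]⟩
  -- The identity is `e`, so `f` becomes a unit with inverse `f*`, and the universal property of the
  -- free group yields `U` with `U(f) = f`. Every word is then `U` of its degree, which makes each
  -- component at most one-dimensional.
  let _ : Monoid (LeavittPathAlgebra K Γ) :=
    { mul_assoc := mul_assoc, one := e, one_mul := fun x => (hone x).1,
      mul_one := fun x => (hone x).2 }
  let U : FreeGroup E →* (LeavittPathAlgebra K Γ)ˣ :=
    FreeGroup.lift fun _ => ⟨edge K Γ f, ghost K Γ f, hfg, hgf⟩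
  have hword : ∀ m : FreeSemigroup (LeavittGen V E),
      mk K Γ (MonoidAlgebra.single m 1) = (U (degree m) : LeavittPathAlgebra K Γ) := by
    intro m
    induction m using FreeSemigroup.recOnMul with
    | ih1 x =>
      rw [mk_single_of, degree_of]
      cases x with
      | vert b => rw [hV b, genDegree, map_one]; rfl
      | edge f' => rw [hE f', genDegree, FreeGroup.lift_apply_of]
      | ghost f' => rw [hE f', genDegree, map_inv, FreeGroup.lift_apply_of]; rfl
    | ih2 x m h1 h2 => rw [mk_single_mul, h1, h2, map_mul, map_mul]; rfl
  have hspan : ∀ (g : FreeGroup E) (x), x ∈ component K Γ g →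
      ∃ c : K, x = c • (U g : LeavittPathAlgebra K Γ) := by
    intro g x hx
    induction hx using Submodule.span_induction with
    | mem x hx => obtain ⟨m, rfl, rfl⟩ := hx; exact ⟨1, by rw [one_smul, hword]⟩
    | zero => exact ⟨0, (zero_smul _ _).symm⟩
    | add x y _ _ hx hy =>
      obtain ⟨c, rfl⟩ := hx
      obtain ⟨d, rfl⟩ := hy
      exact ⟨c + d, (add_smul _ _ _).symm⟩
    | smul c x _ hx =>
      obtain ⟨d, rfl⟩ := hx
      exact ⟨c * d, smul_smul _ _ _⟩
  have hmem : ∀ g : FreeGroup E, (U g : LeavittPathAlgebra K Γ) ∈ component K Γ g := by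
    have hof : ∀ x : LeavittGen V E,
        (U (genDegree x) : LeavittPathAlgebra K Γ) ∈ component K Γ (genDegree x) := by
      intro x
      rw [← degree_of, ← hword]
      exact mk_single_mem _
    intro g
    refine FreeGroup.induction_on g (hof (.vert a)) (fun f' => hof (.edge f'))
      (fun f' _ => hof (.ghost f')) fun g h hg hh => ?_
    rw [map_mul]
    exact component_mul_mem hg hh
  have hinv : ∀ g : FreeGroup E, (U g : LeavittPathAlgebra K Γ) * (U g⁻¹ : _) = e := by
    intro g
    rw [map_inv]
    exact (U g).mul_inv
  refine ⟨e, hone, ?_⟩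
  rintro x ⟨hx0, g, hx⟩
  obtain ⟨c, rfl⟩ := hspan g x hx
  have hc : c ≠ 0 := by rintro rfl; exact hx0 (zero_smul _ _)
  have hxu : (c • (U g : LeavittPathAlgebra K Γ)) * (c⁻¹ • (U g⁻¹ : LeavittPathAlgebra K Γ)) =
      e := by
    rw [smul_mul_assoc, mul_smul_comm, hinv, smul_smul, mul_inv_cancel₀ hc, one_smul]
  have hux : (c⁻¹ • (U g⁻¹ : LeavittPathAlgebra K Γ)) * (c • (U g : LeavittPathAlgebra K Γ)) =
      e := by
    have := hinv g⁻¹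
    rw [inv_inv] at this
    rw [smul_mul_assoc, mul_smul_comm, this, smul_smul, inv_mul_cancel₀ hc, one_smul]
  have hxux : c • (U g : LeavittPathAlgebra K Γ) =
      c • (U g : LeavittPathAlgebra K Γ) * (c⁻¹ • (U g⁻¹ : LeavittPathAlgebra K Γ)) *
        c • (U g : LeavittPathAlgebra K Γ) := by
    rw [hxu, (hone _).1]
  -- For `x = c U(g)` the witness is `x⁻¹ = c⁻¹ U(g⁻¹)`, homogeneous of degree `g⁻¹`.
  refine ⟨c⁻¹ • (U g⁻¹ : LeavittPathAlgebra K Γ), ⟨?_, g⁻¹, ?_⟩, ⟨_, hux, hxu⟩, hxux⟩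
  · intro h0
    rw [h0, mul_zero, zero_mul] at hxux
    exact hx0 hxux
  · exact Submodule.smul_mem (component K Γ g⁻¹) _ (hmem g⁻¹)

end LeavittPathAlgebra

theorem proposition3p5 {K : Type*} [Field K] {V E : Type*} (Γ : DirectedGraph V E)
    (hE : Nonempty E) :
    (LeavittPathAlgebra.freeGroupGrading K Γ).IsGradedUnitRegular ↔ Γ.IsLoop :=
  ⟨LeavittPathAlgebra.isLoop_of_isGradedUnitRegular,
    LeavittPathAlgebra.isGradedUnitRegular_of_isLoop⟩
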